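/- **Setting.** Let $d,q,k,m,s\in\mathbb N$. Let $\mathbb S^n$ be the space of real symmetric $n\times n$ matrices with the trace inner product, $\mathbb S^n_+\subseteq\mathbb S^n$ the cone of positive semidefinite matrices, and $$\widetilde X=\mathbb R^d\times\mathbb R^q\times\mathbb R^{q\times k}\times\prod_{p=1}^q\mathbb S^k\times\mathbb R^m,\qquad \widetilde Y=\prod_{i=1}^m\mathbb S^{k+1},$$ with the product Hilbert structures (Euclidean and Frobenius norms). For a set $S$ let $\iota_S$ be its indicator function ($0$ on $S$, $+\infty$ off $S$) and $P_S(v)$ the point of $S$ nearest to $v$. For $\varphi:V\to\,]-\infty,+\infty]$ on a finite-dimensional Hilbert space $V$ and $t>0$ let $\mathrm{Prox}_{t\varphi}(v)=\operatorname{argmin}_{u\in V}\{\varphi(u)+\frac1{2t}\|u-v\|^2\}$ and $\varphi^*(y)=\sup_{u\in V}\{\langle u,y\rangle-\varphi(u)\}$. Let $f:\mathbb R^d\to\,]-\infty,+\infty]$ be proper, convex and lower semicontinuous; let $\mathcal C\subseteq\mathbb R^d$ be nonempty, closed and convex; let $g_1,\dots,g_s\in\mathbb R[x_1,\dots,x_d]$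 be SOS-convex, that is, the Hessian of each $g_j$ equals $P_j^\top P_j$ for some polynomial matrix $P_j$; and suppose that $\mathcal D=\{x\in\mathbb R^d: g_j(x)\le0,\ j=1,\dots,s\}$ is nonempty. Let $b_i^{(0)}\in\mathbb R$, $\mathbf b_i\in\mathbb R^k$ and $B_i=\begin{bmatrix}0&-\frac12\mathbf b_i\\-\frac12\mathbf b_i^\top&-b_i^{(0)}\end{bmatrix}\in\mathbb S^{k+1}$, $i=1,\dots,m$. For $\widetilde x=(x,y_0,U,\Theta,\lambda)\in\widetilde X$ and $\widetilde y=(\Psi_1,\dots,\Psi_m)\in\widetilde Y$ put $$F(\widetilde x)=f(x)+\sum_{i=1}^m\iota_{\mathbb R_+}(\lambda_i),\quad E(\widetilde x)=\iota_{\mathcal C}(x),\quad H(\widetilde x)=\iota_{\mathcal D}(x),\quad G(\widetilde y)=\sum_{i=1}^m\iota_{B_i+\mathbb S_+^{k+1}}(\Psi_i).$$ Let $\omega$ be the smallest even integer with $\omega\ge2$ and $\omega\ge\deg g_j$ for all $j$, and let $\mathbf N^d_n=\{\alpha\in\mathbb N_0^d:\sum_i\alpha_i\le n\}$. For $\alpha\in\mathbf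 N^d_\omega$ let $M_\alpha$ be the symmetric matrix indexed by $\mathbf N^d_{\omega/2}$ whose $(\beta,\gamma)$ entry is $1$ if $\beta+\gamma=\alpha$ and $0$ otherwise. For $v\in\mathbb R^d$ write $\|v-x\|_2^2=\sum_\alpha h_\alpha x^\alpha$ and $g_j(x)=\sum_\alpha (g_j)_\alpha x^\alpha$, and consider the semidefinite program $$(\mathrm{MP}_v)\qquad \min_{y\in\mathbb R^{\mathbf N^d_\omega}}\Big\{\sum_{\alpha}h_\alpha y_\alpha:\ \sum_{\alpha}(g_j)_\alpha y_\alpha\le0\ (j=1,\dots,s),\ \sum_{\alpha}y_\alpha M_\alpha\succeq0,\ y_0=1\Big\}.$$ **Proposition (Closed-form formulas for proximal operators: two-stage ARO).** Let $\tau,\sigma>0$, $\widetilde x=(x,y_0,U,\Theta,\lambda)\in\widetilde X$ and $\widetilde y=(\Psi_1,\dots,\Psi_m)\in\widetilde Y$. All proximal points and projections below exist and are unique, and: 1. $\mathrm{Prox}_{\tau F}(\widetilde x)=\big(\mathrm{Prox}_{\tau f}(x),\,y_0,\,U,\,\Theta,\,P_{\mathbb R^m_+}(\lambda)\big)$, where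 $P_{\mathbb R^m_+}(\lambda)=(\max\{\lambda_1,0\},\dots,\max\{\lambda_m,0\})$. 2. $\mathrm{Prox}_{\sigma E^*}(\widetilde x)=\big(x-\sigma P_{\mathcal C}(x/\sigma),\,0,\,0,\,0,\,0\big)$. 3. $\mathrm{Prox}_{\sigma G^*}(\widetilde y)=\big(\Psi_i-\sigma B_i-\sigma P_{\mathbb S_+^{k+1}}(\Psi_i/\sigma-B_i)\big)_{i=1}^m$. 4. $\mathrm{Prox}_{\sigma H^*}(\widetilde x)=\big(x-\sigma P_{\mathcal D}(x/\sigma),\,0,\,0,\,0,\,0\big)$. Moreover, for every $v\in\mathbb R^d$ the program $(\mathrm{MP}_v)$ has a solution, and every solution $y^*$ satisfies $P_{\mathcal D}(v)=(y^*_{e_1},\dots,y^*_{e_d})$, where $e_i$ is the multi-index whose $i$-th component is one and whose other components are zero. -/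

import Mathlib

noncomputable section

namespace TwoStageARO

/-! ### Convex analysis in a real inner product space -/

section ConvexAnalysis

variable {V : Type*} [NormedAddCommGroup V] [InnerProductSpace ℝ V]

/-- An extended-real-valued function is proper if it never takes the value `-∞` and is
finite somewhere. -/
def IsProper (f : V → EReal) : Prop :=
  (∀ u, f u ≠ ⊥) ∧ ∃ u, f u ≠ ⊤

/-- Convexity of an extended-real-valued function: its epigraph is convex. -/
def IsConvexFun (f : V → EReal) : Prop :=
  Convex ℝ {p : V × ℝ | f p.1 ≤ (p.2 : EReal)}

open Classical in
/-- The indicator function of a set: `0` on the set and `+∞` elsewhere. -/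
def indicator {W : Type*} (C : Set W) (v : W) : EReal :=
  if v ∈ C then 0 else ⊤

/-- The Fenchel conjugate `f*(y) = sup_u (⟨u, y⟩ - f(u))`. -/
def conjugate (f : V → EReal) (y : V) : EReal :=
  ⨆ u : V, ((inner ℝ u y : ℝ) : EReal) - f u

/-- `Prox_{τ f}(v)`, as the set of all minimisers of `u ↦ f(u) + ‖u - v‖² / (2 τ)`. -/
def prox (τ : ℝ) (f : V → EReal) (v : V) : Set V :=
  {u | ∀ w : V, f u + ((1 / (2 * τ) * ‖u - v‖ ^ 2 : ℝ) : EReal)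
      ≤ f w + ((1 / (2 * τ) * ‖w - v‖ ^ 2 : ℝ) : EReal)}

/-- `P_C(v)`, as the set of all points of `C` that are nearest to `v`. -/
def proj (C : Set V) (v : V) : Set V :=
  {u | u ∈ C ∧ ∀ w ∈ C, ‖u - v‖ ≤ ‖w - v‖}

end ConvexAnalysis

/-! ### Spaces of matrices and the product spaces -/

/-- Real matrices with the Frobenius norm and the trace inner product. -/
abbrev Mat (a b : Type*) [Fintype a] [Fintype b] : Type _ := EuclideanSpace ℝ (a × b)

/-- Real symmetric matrices with the Frobenius norm and the trace inner product. -/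
def SymMat (n : Type*) [Fintype n] : Submodule ℝ (Mat n n) where
  carrier := {A | ∀ i j, A (i, j) = A (j, i)}
  add_mem' := by
    intro A B hA hB i j
    simp [hA i j, hB i j]
  zero_mem' := by
    intro i j
    simp
  smul_mem' := by
    intro c A hA i j
    simp [hA i j]

/-- A symmetric matrix as an element of Mathlib's matrix type. -/
def SymMat.toMatrix {n : Type*} [Fintype n] (A : SymMat n) : Matrix n n ℝ :=
  Matrix.of fun i j => (A : Mat n n) (i, j)

/-- The element of `SymMat n` with the entries of a given symmetric matrix. -/
def SymMat.ofMatrix {n : Type*} [Fintype n] (M : Matrix n n ℝ) (hM : M.IsSymm) : SymMat n :=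
  ⟨WithLp.toLp 2 fun p => M p.1 p.2, fun i j => (hM.apply i j).symm⟩

theorem SymMat.inner_eq_trace {n : Type*} [Fintype n] (A B : SymMat n) :
    inner ℝ A B = (SymMat.toMatrix A * SymMat.toMatrix B).trace := by
  have hB : ∀ i j, (B : Mat n n) (i, j) = (B : Mat n n) (j, i) := B.2
  simp only [Submodule.coe_inner, PiLp.inner_apply, Fintype.sum_prod_type, Matrix.trace,
    Matrix.diag, Matrix.mul_apply, SymMat.toMatrix, Matrix.of_apply]
  refine Finset.sum_congr rfl fun i _ => Finset.sum_congr rfl fun j _ => ?_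
  rw [← hB i j]
  simp [mul_comm]

/-- The cone of positive semidefinite symmetric matrices. -/
def psdCone (n : Type*) [Fintype n] : Set (SymMat n) :=
  {A | (SymMat.toMatrix A).PosSemidef}

/-- The nonnegative orthant. -/
def orthant (m : ℕ) : Set (EuclideanSpace ℝ (Fin m)) :=
  {l | ∀ i, 0 ≤ l i}

/-- The space `ℝ^d × ℝ^q × ℝ^{q×k} × ∏_{p=1}^q 𝕊^k × ℝ^m` with the product Hilbert structure. -/
abbrev XSpace (d q k m : ℕ) : Type :=
  WithLp 2 (EuclideanSpace ℝ (Fin d) × WithLp 2 (EuclideanSpace ℝ (Fin q) ×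
    WithLp 2 (Mat (Fin q) (Fin k) × WithLp 2 (PiLp 2 (fun _ : Fin q => SymMat (Fin k)) ×
      EuclideanSpace ℝ (Fin m)))))

/-- The tuple `(x, y₀, U, Θ, l)`. -/
def XSpace.mk {d q k m : ℕ} (x : EuclideanSpace ℝ (Fin d)) (y₀ : EuclideanSpace ℝ (Fin q))
    (U : Mat (Fin q) (Fin k)) (Θ : PiLp 2 (fun _ : Fin q => SymMat (Fin k)))
    (l : EuclideanSpace ℝ (Fin m)) : XSpace d q k m :=
  WithLp.toLp 2 (x, WithLp.toLp 2 (y₀, WithLp.toLp 2 (U, WithLp.toLp 2 (Θ, l))))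

/-- The component `x` of `(x, y₀, U, Θ, l)`. -/
def XSpace.x {d q k m : ℕ} (z : XSpace d q k m) : EuclideanSpace ℝ (Fin d) := z.fst

/-- The component `l` of `(x, y₀, U, Θ, l)`. -/
def XSpace.l {d q k m : ℕ} (z : XSpace d q k m) : EuclideanSpace ℝ (Fin m) :=
  z.snd.snd.snd.snd

/-- The space `∏_{i=1}^m 𝕊^{k+1}` with the product Hilbert structure; the rows and columns of
a `(k+1) × (k+1)` matrix are indexed by `Fin k ⊕ Unit`. -/
abbrev YSpace (k m : ℕ) : Type :=
  PiLp 2 (fun _ : Fin m => SymMat (Fin k ⊕ Unit))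

/-! ### The functionals of the composite problem -/

/-- `F(x, y₀, U, Θ, l) = f(x) + ∑ i, ι_{ℝ₊}(l_i)`. -/
def F {d : ℕ} (q k m : ℕ) (f : EuclideanSpace ℝ (Fin d) → EReal) (z : XSpace d q k m) : EReal :=
  f z.x + ∑ i, indicator (Set.Ici (0 : ℝ)) (z.l i)

/-- `E(x, y₀, U, Θ, l) = ι_C(x)`. -/
def E {d : ℕ} (q k m : ℕ) (C : Set (EuclideanSpace ℝ (Fin d))) (z : XSpace d q k m) : EReal :=
  indicator C z.x

/-- The block matrix `[[0, -b/2], [-bᵀ/2, -b₀]]`. -/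
def bMatrix {k : ℕ} (b₀ : ℝ) (b : Fin k → ℝ) : SymMat (Fin k ⊕ Unit) :=
  SymMat.ofMatrix
    (Matrix.fromBlocks 0 (Matrix.of fun l _ => -(1 / 2) * b l)
      (Matrix.of fun _ l => -(1 / 2) * b l) (Matrix.of fun _ _ => -b₀))
    (by ext i j; rcases i with i | i <;> rcases j with j | j <;> simp)

/-- `G(Ψ₁, …, Ψ_m) = ∑ i, ι_{B_i + 𝕊₊^{k+1}}(Ψ_i)`. -/
def G {k m : ℕ} (B : Fin m → SymMat (Fin k ⊕ Unit)) (Ψ : YSpace k m) : EReal :=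
  ∑ i, indicator ((fun S => B i + S) '' psdCone (Fin k ⊕ Unit)) (Ψ i)

/-- The set `{x | g_j(x) ≤ 0, j = 1, …, s}`. -/
def feasibleSet {d s : ℕ} (g : Fin s → MvPolynomial (Fin d) ℝ) :
    Set (EuclideanSpace ℝ (Fin d)) :=
  {x | ∀ j, MvPolynomial.eval (fun i => x i) (g j) ≤ 0}

/-- `H(x, y₀, U, Θ, l) = ι_D(x)` with `D = {x | g_j(x) ≤ 0, j = 1, …, s}`. -/
def H {d s : ℕ} (q k m : ℕ) (g : Fin s → MvPolynomial (Fin d) ℝ) (z : XSpace d q k m) : EReal :=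
  indicator (feasibleSet g) z.x

/-! ### SOS-convex polynomials and the moment semidefinite program -/

/-- The Hessian of a polynomial, as a matrix of polynomials. -/
def hessian {d : ℕ} (p : MvPolynomial (Fin d) ℝ) :
    Matrix (Fin d) (Fin d) (MvPolynomial (Fin d) ℝ) :=
  Matrix.of fun i j => MvPolynomial.pderiv i (MvPolynomial.pderiv j p)

/-- A polynomial is SOS-convex if its Hessian is `Pᵀ P` for some polynomial matrix `P`. -/
def IsSOSConvex {d : ℕ} (p : MvPolynomial (Fin d) ℝ) : Prop :=
  ∃ (ν : ℕ) (P : Matrix (Fin ν) (Fin d) (MvPolynomial (Fin d) ℝ)),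
    hessian p = P.transpose * P

/-- The smallest even integer that bounds the degrees of all `g_j` and of the quadratic
polynomial `‖v - x‖²`. -/
def truncOrder {d s : ℕ} (g : Fin s → MvPolynomial (Fin d) ℝ) : ℕ :=
  sInf {n | Even n ∧ 2 ≤ n ∧ ∀ j, (g j).totalDegree ≤ n}

theorem truncOrder_spec {d s : ℕ} (g : Fin s → MvPolynomial (Fin d) ℝ) :
    Even (truncOrder g) ∧ 2 ≤ truncOrder g ∧ ∀ j, (g j).totalDegree ≤ truncOrder g := by
  refine Nat.sInf_mem (s := {n | Even n ∧ 2 ≤ n ∧ ∀ j, (g j).totalDegree ≤ n})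
    ⟨2 * (1 + ∑ j, (g j).totalDegree), even_two_mul _, by omega, fun j => ?_⟩
  have := Finset.single_le_sum (f := fun j => (g j).totalDegree) (fun _ _ => Nat.zero_le _)
    (Finset.mem_univ j)
  omega

/-- The multi-indices in `d` variables of total degree at most `n`. -/
abbrev MultiIndex (d n : ℕ) : Type := {α : Fin d →₀ ℕ // α.degree ≤ n}

instance (d n : ℕ) : Fintype (MultiIndex d n) :=
  (Finsupp.finite_of_degree_le (σ := Fin d) n).fintype

/-- The zero multi-index. -/
def MultiIndex.zero (d n : ℕ) : MultiIndex d n := ⟨0, by simp⟩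

/-- The multi-index whose `i`-th component is one and whose other components vanish. -/
def MultiIndex.unit {d n : ℕ} (hn : 2 ≤ n) (i : Fin d) : MultiIndex d n :=
  ⟨Finsupp.single i 1, by rw [Finsupp.degree_single]; omega⟩

/-- The matrix `B_α`, indexed by the multi-indices of degree at most `n / 2`, whose `(β, γ)`
entry is the coefficient of `x^α` in `x^β x^γ`. -/
def momentBasis {d n : ℕ} (α : MultiIndex d n) :
    Matrix (MultiIndex d (n / 2)) (MultiIndex d (n / 2)) ℝ :=
  Matrix.of fun β γ => if β.1 + γ.1 = α.1 then 1 else 0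

/-- The Riesz functional `∑_α p_α y_α`. -/
def riesz {d n : ℕ} (y : MultiIndex d n → ℝ) (p : MvPolynomial (Fin d) ℝ) : ℝ :=
  ∑ α : MultiIndex d n, p.coeff α.1 * y α

/-- The polynomial `‖v - x‖²` in the variable `x`. -/
def sqDistPoly {d : ℕ} (v : EuclideanSpace ℝ (Fin d)) : MvPolynomial (Fin d) ℝ :=
  ∑ i, (MvPolynomial.C (v i) - MvPolynomial.X i) ^ 2

/-- Feasibility for the moment semidefinite program with truncation order `n`. -/
def IsMomentFeasible {d s n : ℕ} (g : Fin s → MvPolynomial (Fin d) ℝ)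
    (y : MultiIndex d n → ℝ) : Prop :=
  (∀ j, riesz y (g j) ≤ 0) ∧ (∑ α, y α • momentBasis α).PosSemidef ∧
    y (MultiIndex.zero d n) = 1

/-- `y` solves the moment semidefinite program that minimises `∑_α h_α y_α`, with
`h(x) = ‖v - x‖²`, over all feasible `y`. -/
def IsMomentSolution {d s n : ℕ} (g : Fin s → MvPolynomial (Fin d) ℝ)
    (v : EuclideanSpace ℝ (Fin d)) (y : MultiIndex d n → ℝ) : Prop :=
  IsMomentFeasible g y ∧
    ∀ y' : MultiIndex d n → ℝ, IsMomentFeasible g y' →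
      riesz y (sqDistPoly v) ≤ riesz y' (sqDistPoly v)

/-- The vector `(y_{e_1}, …, y_{e_d})` of first moments. -/
def firstMoments {d n : ℕ} (hn : 2 ≤ n) (y : MultiIndex d n → ℝ) :
    EuclideanSpace ℝ (Fin d) :=
  WithLp.toLp 2 fun i => y (MultiIndex.unit hn i)

end TwoStageARO

end

/-!
The objective of a proximal problem for a convex function is strongly convex, so a minimiser is
unique as soon as it exists, and near-minimisers form a Cauchy sequence, so it does exist. By
Moreau's decomposition `Prox_{σ φ*}(v) = v - σ Prox_{φ/σ}(v/σ)`, the formulas for the conjugates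
reduce to proximal points of indicator functions, i.e. to projections, and both proximal points and
projections split along products.

For the moment program, the Riesz functional `L` of a feasible `y` is a pseudo-expectation:
`L 1 = 1` and `L (q²) ≥ 0` whenever `2 deg q ≤ ω`. If `p` is SOS-convex and
`u = (L x₁, …, L x_d)`, then `t ↦ L (p (u + t (x - u)))` has a sum of squares under `L` as second
derivative and vanishing derivative at `t = 0`, which gives Jensen's inequality `p u ≤ L p`.
Applied to the `g_j` and to the objective `‖v - x‖²`, it shows that the first moments of `y` are
feasible and at least as good as `y`, while the moments of the Dirac measure at a feasible point
attain the same value.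
-/

namespace TwoStageARO

section IndicatorFunctions

variable {α : Type*} {K : Set α} {v : α}

theorem indicator_of_mem (hv : v ∈ K) : indicator K v = 0 := if_pos hv

theorem indicator_of_notMem (hv : v ∉ K) : indicator K v = ⊤ := if_neg hv

theorem indicator_nonneg (K : Set α) (v : α) : 0 ≤ indicator K v := by
  by_cases hv : v ∈ K
  · rw [indicator_of_mem hv]
  · simp [indicator_of_notMem hv]

theorem isProper_indicator (hK : K.Nonempty) : IsProper (indicator K) :=
  ⟨fun w => (EReal.bot_lt_zero.trans_le (indicator_nonneg K w)).ne',
    hK.imp fun u hu => by simp [indicator_of_mem hu]⟩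

theorem isProper_zero [Nonempty α] : IsProper (0 : α → EReal) := by simp [IsProper]

end IndicatorFunctions

section SeparableSums

variable {α β : Type*}

/-- The separable function `(u, w) ↦ f u + h w` on an `L²` product. -/
noncomputable def sepSum (f : α → EReal) (h : β → EReal) (z : WithLp 2 (α × β)) : EReal :=
  f z.fst + h z.snd

theorem exists_real_add_le_of_sepSum_le {f : α → EReal} {h : β → EReal}
    (hf : IsProper f) (hh : IsProper h) {z : WithLp 2 (α × β)} {r : ℝ} (hz : sepSum f h z ≤ r) :
    ∃ s t : ℝ, f z.fst = s ∧ h z.snd = t ∧ s + t ≤ r := by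
  have hf_top : f z.fst ≠ ⊤ := by
    intro htop
    simp [sepSum, htop, EReal.top_add_of_ne_bot (hh.1 z.snd)] at hz
  have hh_top : h z.snd ≠ ⊤ := by
    intro htop
    simp [sepSum, htop, EReal.add_top_of_ne_bot (hf.1 z.fst)] at hz
  lift f z.fst to ℝ using ⟨hf_top, hf.1 _⟩ with s hs
  lift h z.snd to ℝ using ⟨hh_top, hh.1 _⟩ with t ht
  refine ⟨s, t, rfl, rfl, ?_⟩
  rw [sepSum, ← hs, ← ht] at hz
  exact_mod_cast hz

theorem isProper_sepSum {f : α → EReal} {h : β → EReal} (hf : IsProper f) (hh : IsProper h) :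
    IsProper (sepSum f h) := by
  obtain ⟨u, hu⟩ := hf.2
  obtain ⟨w, hw⟩ := hh.2
  exact ⟨fun z => EReal.add_ne_bot_iff.2 ⟨hf.1 _, hh.1 _⟩, WithLp.toLp 2 (u, w),
    EReal.add_ne_top hu hw⟩

theorem isProper_zero_sepSum [Nonempty α] {h : β → EReal} (hh : IsProper h) :
    IsProper (sepSum (0 : α → EReal) h) :=
  isProper_sepSum isProper_zero hh

end SeparableSums

section ConvexFunctions

variable {V W : Type*} [NormedAddCommGroup V] [InnerProductSpace ℝ V]
  [NormedAddCommGroup W] [InnerProductSpace ℝ W]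

theorem isConvexFun_indicator {K : Set V} (hK : Convex ℝ K) : IsConvexFun (indicator K) := by
  have epigraph : {p : V × ℝ | indicator K p.1 ≤ (p.2 : EReal)} = K ×ˢ Set.Ici 0 := by
    ext ⟨u, r⟩
    by_cases hu : u ∈ K
    · simp [indicator_of_mem hu, hu]
    · simp [indicator_of_notMem hu, hu]
  rw [IsConvexFun, epigraph]
  exact hK.prod (convex_Ici 0)

theorem isConvexFun_zero : IsConvexFun (0 : V → EReal) := by
  have indicator_univ : (0 : V → EReal) = indicator Set.univ :=
    funext fun u => (indicator_of_mem (Set.mem_univ u)).symm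
  exact indicator_univ ▸ isConvexFun_indicator convex_univ

theorem IsConvexFun.le_of_le {f : V → EReal} (hf : IsConvexFun f) {u w : V} {r s a b : ℝ}
    (hu : f u ≤ r) (hw : f w ≤ s) (ha : 0 ≤ a) (hb : 0 ≤ b) (hab : a + b = 1) :
    f (a • u + b • w) ≤ ((a * r + b * s : ℝ) : EReal) := by
  simpa using hf (x := (u, r)) hu (y := (w, s)) hw ha hb hab

theorem isConvexFun_sepSum {f : V → EReal} {h : W → EReal} (hf : IsConvexFun f)
    (hh : IsConvexFun h) (hf_proper : IsProper f) (hh_proper : IsProper h) :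
    IsConvexFun (sepSum f h) := by
  rintro ⟨z, r⟩ hz ⟨z', r'⟩ hz' a b ha hb hab
  obtain ⟨s, t, hs, ht, hst⟩ := exists_real_add_le_of_sepSum_le hf_proper hh_proper hz
  obtain ⟨s', t', hs', ht', hst'⟩ := exists_real_add_le_of_sepSum_le hf_proper hh_proper hz'
  have real_bound : a * s + b * s' + (a * t + b * t') ≤ a * r + b * r' := by
    linarith [mul_le_mul_of_nonneg_left hst ha, mul_le_mul_of_nonneg_left hst' hb]
  calc sepSum f h (a • z + b • z')
      ≤ ((a * s + b * s' : ℝ) : EReal) + ((a * t + b * t' : ℝ) : EReal) :=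
        add_le_add (hf.le_of_le hs.le hs'.le ha hb hab) (hh.le_of_le ht.le ht'.le ha hb hab)
    _ ≤ ((a * r + b * r' : ℝ) : EReal) := by exact_mod_cast real_bound

theorem isConvexFun_zero_sepSum {h : W → EReal} (hh : IsConvexFun h) :
    IsConvexFun (sepSum (0 : V → EReal) h) := by
  rintro ⟨z, r⟩ hz ⟨z', r'⟩ hz' a b ha hb hab
  have hle := hh.le_of_le ((zero_add _).symm.trans_le hz) ((zero_add _).symm.trans_le hz') ha hb hab
  exact (zero_add _).trans_le hle

end ConvexFunctions

section ProximalObjective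

variable {V : Type*} [NormedAddCommGroup V] {f : V → EReal} {τ : ℝ} {v : V}

/-- The function `u ↦ f u + ‖u - v‖² / (2 τ)` whose minimisers form `prox τ f v`. -/
noncomputable def proxObjective (τ : ℝ) (f : V → EReal) (v u : V) : EReal :=
  f u + ((1 / (2 * τ) * ‖u - v‖ ^ 2 : ℝ) : EReal)

theorem mem_prox_iff {p : V} :
    p ∈ prox τ f v ↔ ∀ w, proxObjective τ f v p ≤ proxObjective τ f v w := Iff.rfl

theorem proxObjective_le_coe_iff {u : V} {r : ℝ} :
    proxObjective τ f v u ≤ r ↔ f u ≤ ((r - 1 / (2 * τ) * ‖u - v‖ ^ 2 : ℝ) : EReal) := by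
  rw [EReal.coe_sub, EReal.le_sub_iff_add_le (by simp) (by simp), proxObjective]

theorem IsProper.ne_top_of_mem_prox (hf : IsProper f) {p : V} (hp : p ∈ prox τ f v) :
    f p ≠ ⊤ := by
  intro htop
  obtain ⟨u, hu⟩ := hf.2
  have hle := hp u
  rw [htop, EReal.top_add_coe, top_le_iff] at hle
  exact EReal.add_ne_top hu (EReal.coe_ne_top _) hle

theorem IsProper.exists_coe_eq_of_mem_prox (hf : IsProper f) {p : V} (hp : p ∈ prox τ f v) :
    ∃ r : ℝ, f p = r :=
  ⟨_, (EReal.coe_toReal (hf.ne_top_of_mem_prox hp) (hf.1 p)).symm⟩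

theorem lowerSemicontinuous_proxObjective (hf : LowerSemicontinuous f) (τ : ℝ) (v : V) :
    LowerSemicontinuous (proxObjective τ f v) :=
  hf.add' (continuous_coe_real_ereal.comp (by fun_prop)).lowerSemicontinuous fun _ =>
    EReal.continuousAt_add (Or.inr (EReal.coe_ne_bot _)) (Or.inr (EReal.coe_ne_top _))

theorem prox_eq_singleton_of_add_norm_sq_le (hτ : 0 < τ) {p : V} {r : ℝ}
    (hr : proxObjective τ f v p = r)
    (hgrowth : ∀ w, ((r + 1 / (2 * τ) * ‖w - p‖ ^ 2 : ℝ) : EReal) ≤ proxObjective τ f v w) :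
    prox τ f v = {p} := by
  refine Set.Subset.antisymm (fun u hu => ?_) (Set.singleton_subset_iff.2 fun w => ?_)
  · have hle := (hgrowth u).trans ((mem_prox_iff.1 hu p).trans_eq hr)
    have hsq : 1 / (2 * τ) * ‖u - p‖ ^ 2 ≤ 0 := by
      linarith [EReal.coe_le_coe_iff.1 hle]
    have hzero : ‖u - p‖ ^ 2 ≤ 0 := nonpos_of_mul_nonpos_right hsq (by positivity)
    simpa [sub_eq_zero] using hzero.antisymm (sq_nonneg _)
  · refine le_trans ?_ (hgrowth w)
    rw [← proxObjective, hr, EReal.coe_le_coe_iff]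
    exact le_add_of_nonneg_right (by positivity)

end ProximalObjective

section StrongConvexity

variable {V : Type*} [NormedAddCommGroup V] [InnerProductSpace ℝ V] {f : V → EReal} {τ : ℝ} {v : V}

theorem norm_combo_sq (u w : V) {a b : ℝ} (hab : a + b = 1) :
    ‖a • u + b • w‖ ^ 2 = a * ‖u‖ ^ 2 + b * ‖w‖ ^ 2 - a * b * ‖u - w‖ ^ 2 := by
  obtain rfl : b = 1 - a := by linarith
  rw [norm_add_sq_real, norm_sub_sq_real, norm_smul, norm_smul, inner_smul_left, inner_smul_right,
    mul_pow, mul_pow, Real.norm_eq_abs, Real.norm_eq_abs, sq_abs, sq_abs, conj_trivial]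
  ring

theorem IsConvexFun.proxObjective_combo_le (hf : IsConvexFun f) {u w : V} {r s a b : ℝ}
    (hu : proxObjective τ f v u ≤ r) (hw : proxObjective τ f v w ≤ s)
    (ha : 0 ≤ a) (hb : 0 ≤ b) (hab : a + b = 1) :
    proxObjective τ f v (a • u + b • w) ≤
      ((a * r + b * s - a * b * (1 / (2 * τ) * ‖u - w‖ ^ 2) : ℝ) : EReal) := by
  have hcombo := hf.le_of_le (proxObjective_le_coe_iff.1 hu) (proxObjective_le_coe_iff.1 hw)
    ha hb hab
  have hnorm : ‖a • u + b • w - v‖ ^ 2 =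
      a * ‖u - v‖ ^ 2 + b * ‖w - v‖ ^ 2 - a * b * ‖u - w‖ ^ 2 := by
    rw [← sub_sub_sub_cancel_right u w v, ← norm_combo_sq (u - v) (w - v) hab, smul_sub, smul_sub,
      sub_add_sub_comm, ← add_smul, hab, one_smul]
  rw [proxObjective_le_coe_iff, hnorm]
  refine hcombo.trans_eq ?_
  norm_cast
  ring

theorem IsConvexFun.add_norm_sq_le_proxObjective (hf : IsConvexFun f) {p : V} {r : ℝ}
    (hp : p ∈ prox τ f v) (hr : proxObjective τ f v p = r) (w : V) :
    ((r + 1 / (2 * τ) * ‖w - p‖ ^ 2 : ℝ) : EReal) ≤ proxObjective τ f v w := by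
  refine EReal.le_of_forall_lt_iff_le.1 fun s hs => ?_
  have on_segment : ∀ t ∈ Set.Ioo (0 : ℝ) 1, r + (1 - t) * (1 / (2 * τ) * ‖w - p‖ ^ 2) ≤ s := by
    intro t ⟨ht₀, ht₁⟩
    have hle := (hp _).trans
      (hf.proxObjective_combo_le hs.le hr.le ht₀.le (sub_nonneg.2 ht₁.le) (by ring))
    rw [← proxObjective, hr, EReal.coe_le_coe_iff] at hle
    exact le_of_mul_le_mul_left (by linarith) ht₀
  have hlim : Filter.Tendsto (fun t : ℝ => r + (1 - t) * (1 / (2 * τ) * ‖w - p‖ ^ 2))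
      (nhdsWithin 0 (Set.Ioi 0)) (nhds (r + (1 - 0) * (1 / (2 * τ) * ‖w - p‖ ^ 2))) :=
    Continuous.continuousWithinAt (by fun_prop)
  rw [sub_zero, one_mul] at hlim
  exact EReal.coe_le_coe_iff.2 <| le_of_tendsto hlim <|
    Filter.mem_of_superset (Ioo_mem_nhdsGT zero_lt_one) on_segment

theorem prox_eq_singleton_of_mem (hf_proper : IsProper f) (hf_convex : IsConvexFun f) (hτ : 0 < τ)
    {p : V} (hp : p ∈ prox τ f v) : prox τ f v = {p} := by
  obtain ⟨r, hr⟩ := hf_proper.exists_coe_eq_of_mem_prox hp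
  have hobj : proxObjective τ f v p = ((r + 1 / (2 * τ) * ‖p - v‖ ^ 2 : ℝ) : EReal) := by
    rw [proxObjective, hr, EReal.coe_add]
  exact prox_eq_singleton_of_add_norm_sq_le hτ hobj
    (hf_convex.add_norm_sq_le_proxObjective hp hobj)

end StrongConvexity

section MoreauDecomposition

variable {V : Type*} [NormedAddCommGroup V] [InnerProductSpace ℝ V] {f : V → EReal} {τ σ : ℝ}
  {v p : V}

theorem IsConvexFun.add_inner_le_of_mem_prox (hf : IsConvexFun f) {r : ℝ} (hp : p ∈ prox τ f v)
    (hr : f p = r) (w : V) :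
    ((r + inner ℝ (τ⁻¹ • (v - p)) (w - p) : ℝ) : EReal) ≤ f w := by
  have hobj : proxObjective τ f v p = ((r + 1 / (2 * τ) * ‖p - v‖ ^ 2 : ℝ) : EReal) := by
    rw [proxObjective, hr, EReal.coe_add]
  have hgrowth := hf.add_norm_sq_le_proxObjective hp hobj w
  have hexpand : ‖w - v‖ ^ 2 = ‖w - p‖ ^ 2 - 2 * inner ℝ (v - p) (w - p) + ‖p - v‖ ^ 2 := by
    rw [← sub_sub_sub_cancel_right w v p, norm_sub_sq_real, norm_sub_rev v p, real_inner_comm]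
  have hfactor : 1 / (2 * τ) * 2 = τ⁻¹ := by ring
  rw [proxObjective, ← EReal.sub_le_iff_le_add (Or.inl (EReal.coe_ne_bot _))
    (Or.inl (EReal.coe_ne_top _)), ← EReal.coe_sub] at hgrowth
  refine le_of_eq_of_le ?_ hgrowth
  rw [hexpand, inner_smul_left, conj_trivial, ← hfactor]
  norm_cast
  ring

theorem inner_sub_le_conjugate {r : ℝ} (hr : f p = r) (w : V) :
    ((inner ℝ p w - r : ℝ) : EReal) ≤ conjugate f w := by
  rw [EReal.coe_sub, ← hr]
  exact le_iSup (fun u : V => ((inner ℝ u w : ℝ) : EReal) - f u) p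

theorem conjugate_eq_of_forall_add_inner_le {r : ℝ} {w : V} (hr : f p = r)
    (hw : ∀ u, ((r + inner ℝ w (u - p) : ℝ) : EReal) ≤ f u) :
    conjugate f w = ((inner ℝ p w - r : ℝ) : EReal) := by
  refine le_antisymm (iSup_le fun u => ?_) (inner_sub_le_conjugate hr w)
  refine (EReal.sub_le_sub le_rfl (hw u)).trans_eq ?_
  rw [inner_sub_right, real_inner_comm u w, real_inner_comm p w]
  norm_cast
  ring

theorem prox_conjugate (hf_proper : IsProper f) (hf_convex : IsConvexFun f) (hσ : 0 < σ)
    (hp : p ∈ prox σ⁻¹ f (σ⁻¹ • v)) : prox σ (conjugate f) v = {v - σ • p} := by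
  obtain ⟨r, hr⟩ := hf_proper.exists_coe_eq_of_mem_prox hp
  have hdual : σ⁻¹⁻¹ • (σ⁻¹ • v - p) = v - σ • p := by
    rw [inv_inv, smul_sub, smul_inv_smul₀ hσ.ne']
  have hvalue : conjugate f (v - σ • p) = ((inner ℝ p (v - σ • p) - r : ℝ) : EReal) :=
    conjugate_eq_of_forall_add_inner_le hr <|
      hdual ▸ hf_convex.add_inner_le_of_mem_prox hp hr
  have hobj : proxObjective σ (conjugate f) v (v - σ • p) =
      ((inner ℝ p (v - σ • p) - r + 1 / (2 * σ) * ‖(v - σ • p) - v‖ ^ 2 : ℝ) : EReal) := by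
    rw [proxObjective, hvalue, EReal.coe_add]
  have complete_square (w : V) :
      inner ℝ p (v - σ • p) - r + 1 / (2 * σ) * ‖(v - σ • p) - v‖ ^ 2 +
        1 / (2 * σ) * ‖w - (v - σ • p)‖ ^ 2 = inner ℝ p w - r + 1 / (2 * σ) * ‖w - v‖ ^ 2 := by
    obtain ⟨x, rfl⟩ : ∃ x, w = v + x := ⟨w - v, by abel⟩
    rw [sub_sub_cancel_left, norm_neg, add_sub_sub_cancel, add_sub_cancel_left,
      norm_add_sq_real, inner_sub_right, inner_add_right, inner_smul_right, inner_smul_right,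
      norm_smul, real_inner_self_eq_norm_sq, mul_pow, Real.norm_eq_abs, sq_abs, real_inner_comm x p]
    field_simp
    ring
  refine prox_eq_singleton_of_add_norm_sq_le hσ hobj fun w => ?_
  rw [complete_square, EReal.coe_add]
  exact add_le_add (inner_sub_le_conjugate hr w) le_rfl

end MoreauDecomposition

section Existence

variable {V : Type*} [NormedAddCommGroup V] [InnerProductSpace ℝ V] {f : V → EReal} {τ : ℝ}

theorem IsConvexFun.exists_sub_norm_div_le (hf_convex : IsConvexFun f)
    (hf_lsc : LowerSemicontinuous f) {u₀ : V} {e : ℝ} (he : f u₀ = e) :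
    ∃ δ > 0, ∀ u, ((e - 1 - ‖u - u₀‖ / δ : ℝ) : EReal) ≤ f u := by
  have hlt : ((e - 1 : ℝ) : EReal) < f u₀ := he ▸ EReal.coe_lt_coe_iff.2 (sub_one_lt e)
  have hnear : ∀ᶠ u in nhds u₀, ((e - 1 : ℝ) : EReal) < f u := hf_lsc u₀ _ hlt
  obtain ⟨δ, hδ, hball⟩ := Metric.eventually_nhds_iff.1 hnear
  refine ⟨δ, hδ, fun u => le_of_not_gt fun hu => ?_⟩
  -- A violation at `u` propagates along the segment to a point of the `δ`-ball around `u₀`.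
  set t := δ / (δ + ‖u - u₀‖)
  have hden : 0 < δ + ‖u - u₀‖ := by positivity
  have ht₁ : t ≤ 1 := div_le_one_of_le₀ (by simp) hden.le
  have hclose : dist ((1 - t) • u₀ + t • u) u₀ < δ := by
    have hsub : (1 - t) • u₀ + t • u - u₀ = t • (u - u₀) := by module
    rw [dist_eq_norm, hsub, norm_smul, Real.norm_of_nonneg (by positivity), div_mul_eq_mul_div,
      div_lt_iff₀ hden]
    nlinarith
  have hvalue : (1 - t) * e + t * (e - 1 - ‖u - u₀‖ / δ) = e - 1 := by
    have ht : t * (1 + ‖u - u₀‖ / δ) = 1 := by simp only [t]; field_simp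
    linear_combination -ht
  have hcombo := hf_convex.le_of_le he.le hu.le (sub_nonneg.2 ht₁) (by positivity : 0 ≤ t) (by ring)
  rw [hvalue] at hcombo
  exact (hball hclose).not_ge hcombo

theorem exists_forall_coe_le_proxObjective (hf_proper : IsProper f) (hf_convex : IsConvexFun f)
    (hf_lsc : LowerSemicontinuous f) (hτ : 0 < τ) (v : V) :
    ∃ μ : ℝ, ∀ u, (μ : EReal) ≤ proxObjective τ f v u := by
  obtain ⟨u₀, hu₀⟩ := hf_proper.2
  obtain ⟨δ, hδ, hminorant⟩ := hf_convex.exists_sub_norm_div_le hf_lsc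
    (EReal.coe_toReal hu₀ (hf_proper.1 u₀)).symm
  refine ⟨(f u₀).toReal - 1 - ‖u₀ - v‖ / δ - τ / 2 * δ⁻¹ ^ 2, fun u => ?_⟩
  refine le_trans ?_ (add_le_add (hminorant u) le_rfl)
  rw [← EReal.coe_add, EReal.coe_le_coe_iff]
  have htriangle : ‖u - u₀‖ / δ ≤ ‖u - v‖ / δ + ‖u₀ - v‖ / δ := by
    rw [← add_div, norm_sub_rev u₀ v]
    gcongr
    exact norm_sub_le_norm_sub_add_norm_sub u v u₀
  have hquadratic : ‖u - v‖ / δ ≤ 1 / (2 * τ) * ‖u - v‖ ^ 2 + τ / 2 * δ⁻¹ ^ 2 := by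
    have hsquare : 1 / (2 * τ) * ‖u - v‖ ^ 2 + τ / 2 * δ⁻¹ ^ 2 - ‖u - v‖ / δ =
        1 / (2 * τ) * (‖u - v‖ - τ / δ) ^ 2 := by
      field_simp
      ring
    exact sub_nonneg.1 (hsquare ▸ by positivity)
  linarith

theorem IsConvexFun.norm_sub_sq_le_of_proxObjective_le (hf : IsConvexFun f) (hτ : 0 < τ)
    {v u w : V} {μ ε : ℝ} (hμ : ∀ z, (μ : EReal) ≤ proxObjective τ f v z)
    (hu : proxObjective τ f v u ≤ ((μ + ε : ℝ) : EReal))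
    (hw : proxObjective τ f v w ≤ ((μ + ε : ℝ) : EReal)) : ‖u - w‖ ^ 2 ≤ 8 * τ * ε := by
  have hmid := (hμ _).trans (hf.proxObjective_combo_le hu hw
    (by norm_num : (0 : ℝ) ≤ 1 / 2) (by norm_num : (0 : ℝ) ≤ 1 / 2) (by norm_num))
  rw [EReal.coe_le_coe_iff] at hmid
  have hbound : ‖u - w‖ ^ 2 / (8 * τ) ≤ ε := by
    have hscale : 1 / 2 * (1 / 2) * (1 / (2 * τ) * ‖u - w‖ ^ 2) = ‖u - w‖ ^ 2 / (8 * τ) := by ring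
    linarith
  rwa [div_le_iff₀' (by positivity)] at hbound

theorem exists_iInf_proxObjective_eq_coe (hf_proper : IsProper f) (hf_convex : IsConvexFun f)
    (hf_lsc : LowerSemicontinuous f) (hτ : 0 < τ) (v : V) :
    ∃ μ : ℝ, ⨅ u, proxObjective τ f v u = μ := by
  obtain ⟨m, hm⟩ := exists_forall_coe_le_proxObjective hf_proper hf_convex hf_lsc hτ v
  obtain ⟨u₀, hu₀⟩ := hf_proper.2
  refine ⟨_, (EReal.coe_toReal (ne_top_of_le_ne_top ?_ (iInf_le _ u₀)) ?_).symm⟩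
  · exact EReal.add_ne_top hu₀ (EReal.coe_ne_top _)
  · exact ne_bot_of_le_ne_bot (EReal.coe_ne_bot m) (le_iInf hm)

theorem prox_nonempty [CompleteSpace V] (hf_proper : IsProper f) (hf_convex : IsConvexFun f)
    (hf_lsc : LowerSemicontinuous f) (hτ : 0 < τ) (v : V) : (prox τ f v).Nonempty := by
  obtain ⟨μ, hμ⟩ := exists_iInf_proxObjective_eq_coe hf_proper hf_convex hf_lsc hτ v
  have hμ_le (u : V) : (μ : EReal) ≤ proxObjective τ f v u := hμ ▸ iInf_le _ u
  have exists_near_min (n : ℕ) :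
      ∃ u, proxObjective τ f v u < ((μ + 1 / (n + 1) : ℝ) : EReal) := by
    rw [← iInf_lt_iff, hμ, EReal.coe_lt_coe_iff]
    exact lt_add_of_pos_right _ (by positivity)
  choose u hu using exists_near_min
  have hu_le {N n : ℕ} (hn : N ≤ n) :
      proxObjective τ f v (u n) ≤ ((μ + 1 / (N + 1) : ℝ) : EReal) :=
    (hu n).le.trans <| EReal.coe_le_coe_iff.2 <| by gcongr
  have hcauchy : CauchySeq u := by
    refine cauchySeq_of_le_tendsto_0 (fun N : ℕ => √(8 * τ * (1 / (N + 1))))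
      (fun n k N hn hk => ?_) ?_
    · rw [dist_eq_norm]
      exact Real.le_sqrt_of_sq_le <|
        hf_convex.norm_sub_sq_le_of_proxObjective_le hτ hμ_le (hu_le hn) (hu_le hk)
    · simpa using (tendsto_one_div_add_atTop_nhds_zero_nat.const_mul (8 * τ)).sqrt
  obtain ⟨p, hp⟩ := cauchySeq_tendsto_of_complete hcauchy
  refine ⟨p, fun w => le_trans ?_ (hμ_le w)⟩
  have hp_le (N : ℕ) : proxObjective τ f v p ≤ ((μ + 1 / (N + 1) : ℝ) : EReal) :=
    ((lowerSemicontinuous_proxObjective hf_lsc τ v).isClosed_preimage _).mem_of_tendsto hp <|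
      (Filter.eventually_ge_atTop N).mono fun n hn => hu_le hn
  have hlim : Filter.Tendsto (fun N : ℕ => ((μ + 1 / (N + 1) : ℝ) : EReal)) Filter.atTop
      (nhds (μ : EReal)) := by
    refine (continuous_coe_real_ereal.tendsto μ).comp ?_
    simpa using tendsto_one_div_add_atTop_nhds_zero_nat.const_add μ
  exact ge_of_tendsto' hlim hp_le

theorem exists_prox_eq_singleton [CompleteSpace V] (hf_proper : IsProper f)
    (hf_convex : IsConvexFun f) (hf_lsc : LowerSemicontinuous f) (hτ : 0 < τ) (v : V) :
    ∃ p, prox τ f v = {p} :=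
  (prox_nonempty hf_proper hf_convex hf_lsc hτ v).imp fun _ =>
    prox_eq_singleton_of_mem hf_proper hf_convex hτ

end Existence

section Projections

variable {V : Type*} [NormedAddCommGroup V] {K : Set V} {v p : V}

theorem prox_indicator (hK : K.Nonempty) {τ : ℝ} (hτ : 0 < τ) (v : V) :
    prox τ (indicator K) v = proj K v := by
  have sq_le_iff (u w : V) :
      1 / (2 * τ) * ‖u - v‖ ^ 2 ≤ 1 / (2 * τ) * ‖w - v‖ ^ 2 ↔ ‖u - v‖ ≤ ‖w - v‖ := by
    rw [mul_le_mul_iff_right₀ (by positivity), sq_le_sq₀ (norm_nonneg _) (norm_nonneg _)]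
  ext u
  constructor
  · intro hu
    have hu_mem : u ∈ K := by
      by_contra hu_notMem
      exact (isProper_indicator hK).ne_top_of_mem_prox hu (indicator_of_notMem hu_notMem)
    refine ⟨hu_mem, fun w hw => (sq_le_iff u w).1 ?_⟩
    simpa only [indicator_of_mem hu_mem, indicator_of_mem hw, zero_add, EReal.coe_le_coe_iff]
      using hu w
  · rintro ⟨hu_mem, hmin⟩ w
    by_cases hw : w ∈ K
    · simpa only [indicator_of_mem hu_mem, indicator_of_mem hw, zero_add, EReal.coe_le_coe_iff]
        using (sq_le_iff u w).2 (hmin w hw)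
    · rw [indicator_of_notMem hw, EReal.top_add_coe]
      exact le_top

theorem add_mem_proj_image_add {b : V} (hp : p ∈ proj K (v - b)) :
    b + p ∈ proj ((fun u => b + u) '' K) v := by
  have hshift (u : V) : b + u - v = u - (v - b) := by abel
  refine ⟨Set.mem_image_of_mem _ hp.1, ?_⟩
  rintro _ ⟨w, hw, rfl⟩
  simpa only [hshift] using hp.2 w hw

variable [InnerProductSpace ℝ V]

theorem proj_eq_singleton_of_mem (hK : Convex ℝ K) (hp : p ∈ proj K v) : proj K v = {p} := by
  have hne : K.Nonempty := ⟨p, hp.1⟩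
  rw [← prox_indicator hne one_pos] at hp ⊢
  exact prox_eq_singleton_of_mem (isProper_indicator hne) (isConvexFun_indicator hK) one_pos hp

theorem exists_proj_eq_singleton [CompleteSpace V] (hK_nonempty : K.Nonempty)
    (hK_closed : IsClosed K) (hK_convex : Convex ℝ K) (v : V) : ∃ p, proj K v = {p} := by
  obtain ⟨p, hp, hmin⟩ := exists_norm_eq_iInf_of_complete_convex hK_nonempty hK_closed.isComplete
    hK_convex v
  refine ⟨p, proj_eq_singleton_of_mem hK_convex ⟨hp, fun w hw => ?_⟩⟩
  rw [norm_sub_rev p, norm_sub_rev w, hmin]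
  exact ciInf_le ⟨0, Set.forall_mem_range.2 fun _ => norm_nonneg _⟩ (⟨w, hw⟩ : K)

end Projections

section Products

variable {V W : Type*} [NormedAddCommGroup V] [NormedAddCommGroup W]
  {f : V → EReal} {h : W → EReal} {τ σ : ℝ}

theorem self_mem_prox_zero (hτ : 0 < τ) (v : V) : v ∈ prox τ (0 : V → EReal) v := by
  intro w
  rw [sub_self, norm_zero, zero_pow two_ne_zero, mul_zero]
  exact add_le_add le_rfl (EReal.coe_le_coe_iff.2 (by positivity))

theorem mem_prox_sepSum {v p : V} {w r : W} (hp : p ∈ prox τ f v) (hr : r ∈ prox τ h w) :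
    WithLp.toLp 2 (p, r) ∈ prox τ (sepSum f h) (WithLp.toLp 2 (v, w)) := by
  have hsplit (z : WithLp 2 (V × W)) : proxObjective τ (sepSum f h) (WithLp.toLp 2 (v, w)) z =
      proxObjective τ f v z.fst + proxObjective τ h w z.snd := by
    rw [proxObjective, proxObjective, proxObjective, sepSum, add_add_add_comm, ← EReal.coe_add,
      ← mul_add, WithLp.prod_norm_sq_eq_of_L2]
    rfl
  refine mem_prox_iff.2 fun z => ?_
  rw [hsplit, hsplit]
  exact add_le_add (hp z.fst) (hr z.snd)

variable [InnerProductSpace ℝ V] [InnerProductSpace ℝ W]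

theorem prox_sepSum (hf_proper : IsProper f) (hf_convex : IsConvexFun f) (hh_proper : IsProper h)
    (hh_convex : IsConvexFun h) (hτ : 0 < τ) {v p : V} {w r : W} (hp : p ∈ prox τ f v)
    (hr : r ∈ prox τ h w) :
    prox τ (sepSum f h) (WithLp.toLp 2 (v, w)) = {WithLp.toLp 2 (p, r)} :=
  prox_eq_singleton_of_mem (isProper_sepSum hf_proper hh_proper)
    (isConvexFun_sepSum hf_convex hh_convex hf_proper hh_proper) hτ (mem_prox_sepSum hp hr)

theorem prox_conjugate_sepSum_zero (hf_proper : IsProper f) (hf_convex : IsConvexFun f)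
    (hσ : 0 < σ) {v p : V} (w : W) (hp : p ∈ prox σ⁻¹ f (σ⁻¹ • v)) :
    prox σ (conjugate (sepSum f (0 : W → EReal))) (WithLp.toLp 2 (v, w)) =
      {WithLp.toLp 2 (v - σ • p, 0)} := by
  have hmem := mem_prox_sepSum hp (self_mem_prox_zero (inv_pos.2 hσ) (σ⁻¹ • w))
  rw [prox_conjugate (v := WithLp.toLp 2 (v, w)) (isProper_sepSum hf_proper isProper_zero)
    (isConvexFun_sepSum hf_convex isConvexFun_zero hf_proper isProper_zero) hσ hmem,
    ← WithLp.toLp_smul, ← WithLp.toLp_sub, Prod.smul_mk, Prod.mk_sub_mk, smul_inv_smul₀ hσ.ne',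
    sub_self]

end Products

section PiProducts

variable {ι : Type*} {W : ι → Type*} {K : ∀ i, Set (W i)}

/-- The product of the sets `K i`, as a subset of the `L²` product of the ambient spaces. -/
def piProduct (K : ∀ i, Set (W i)) : Set (PiLp 2 W) := {w | ∀ i, w i ∈ K i}

theorem convex_piProduct [∀ i, AddCommGroup (W i)] [∀ i, Module ℝ (W i)]
    (hK : ∀ i, Convex ℝ (K i)) : Convex ℝ (piProduct K) :=
  fun _ hu _ hw _ _ ha hb hab i => hK i (hu i) (hw i) ha hb hab

variable [Fintype ι]

theorem sum_indicator (K : ∀ i, Set (W i)) (w : PiLp 2 W) :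
    ∑ i, indicator (K i) (w i) = indicator (piProduct K) w := by
  by_cases hw : w ∈ piProduct K
  · rw [indicator_of_mem hw]
    exact Finset.sum_eq_zero fun i _ => indicator_of_mem (hw i)
  · obtain ⟨i, hi⟩ := not_forall.1 hw
    rw [indicator_of_notMem hw, eq_top_iff, ← indicator_of_notMem hi]
    exact Finset.single_le_sum (f := fun j => indicator (K j) (w j))
      (fun j _ => indicator_nonneg (K j) (w j)) (Finset.mem_univ i)

variable [∀ i, NormedAddCommGroup (W i)]

theorem mem_proj_piProduct {v p : PiLp 2 W} (hp : ∀ i, p i ∈ proj (K i) (v i)) :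
    p ∈ proj (piProduct K) v := by
  refine ⟨fun i => (hp i).1, fun w hw => ?_⟩
  rw [← sq_le_sq₀ (norm_nonneg _) (norm_nonneg _), PiLp.norm_sq_eq_of_L2, PiLp.norm_sq_eq_of_L2]
  exact Finset.sum_le_sum fun i _ => pow_le_pow_left₀ (norm_nonneg _) ((hp i).2 (w i) (hw i)) 2

end PiProducts

section PiProductsOfTranslates

variable {ι : Type*} [Fintype ι] {W : ι → Type*} [∀ i, NormedAddCommGroup (W i)]
  [∀ i, InnerProductSpace ℝ (W i)] {K : ∀ i, Set (W i)}

theorem prox_conjugate_sum_indicator_image_add (hK : ∀ i, Convex ℝ (K i)) {σ : ℝ} (hσ : 0 < σ)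
    {v b p : PiLp 2 W} (hp : ∀ i, p i ∈ proj (K i) (σ⁻¹ • v i - b i)) :
    prox σ (conjugate fun w : PiLp 2 W => ∑ i, indicator ((fun u => b i + u) '' K i) (w i)) v =
      {v - σ • b - σ • p} := by
  simp only [sum_indicator]
  have hproj : b + p ∈ proj (piProduct fun i => (fun u => b i + u) '' K i) (σ⁻¹ • v) :=
    mem_proj_piProduct fun i => add_mem_proj_image_add (hp i)
  have hne := Set.nonempty_of_mem hproj.1
  rw [← prox_indicator hne (inv_pos.2 hσ)] at hproj
  rw [prox_conjugate (isProper_indicator hne)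
    (isConvexFun_indicator (convex_piProduct fun i => (hK i).translate (b i))) hσ hproj,
    smul_add, sub_sub]

end PiProductsOfTranslates

section Cones

theorem psdCone_nonempty (n : Type*) [Fintype n] : (psdCone n).Nonempty :=
  ⟨0, Matrix.PosSemidef.zero⟩

theorem convex_psdCone (n : Type*) [Fintype n] : Convex ℝ (psdCone n) :=
  fun _ hA _ hB _ _ ha hb _ => (Matrix.PosSemidef.smul hA ha).add (Matrix.PosSemidef.smul hB hb)

theorem isClosed_psdCone (n : Type*) [Fintype n] : IsClosed (psdCone n) := by
  have hforms : psdCone n =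
      ⋂ x : n → ℝ, {A : SymMat n | 0 ≤ x ⬝ᵥ (SymMat.toMatrix A).mulVec x} := by
    ext A
    have hA : (SymMat.toMatrix A).IsHermitian := Matrix.IsHermitian.ext fun i j => A.2 j i
    simp only [psdCone, Set.mem_ofPred_eq, Set.mem_iInter, Matrix.posSemidef_iff_dotProduct_mulVec]
    exact ⟨fun h => h.2, fun h => ⟨hA, h⟩⟩
  rw [hforms]
  refine isClosed_iInter fun x => isClosed_le continuous_const ?_
  simp only [dotProduct, Matrix.mulVec, SymMat.toMatrix, Matrix.of_apply]
  fun_prop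

theorem max_zero_mem_proj_Ici (a : ℝ) : max a 0 ∈ proj (Set.Ici 0) a := by
  refine ⟨le_max_right a 0, fun w (hw : 0 ≤ w) => ?_⟩
  rcases le_total a 0 with ha | ha
  · rw [max_eq_right ha, Real.norm_of_nonneg (by linarith), Real.norm_of_nonneg (by linarith)]
    linarith
  · simp [max_eq_left ha]

variable {m : ℕ}

theorem convex_orthant : Convex ℝ (orthant m) := convex_piProduct fun _ => convex_Ici 0

theorem proj_orthant (l : EuclideanSpace ℝ (Fin m)) :
    proj (orthant m) l = {WithLp.toLp 2 fun i => max (l i) 0} :=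
  proj_eq_singleton_of_mem convex_orthant <|
    mem_proj_piProduct fun i => max_zero_mem_proj_Ici (l i)

end Cones

section Functionals

variable {d q k m : ℕ} {τ σ : ℝ} {x p : EuclideanSpace ℝ (Fin d)}

theorem F_eq_sepSum (f : EuclideanSpace ℝ (Fin d) → EReal) :
    F q k m f = sepSum f (sepSum 0 (sepSum 0 (sepSum 0 (indicator (orthant m))))) := by
  funext z
  simp only [sepSum, Pi.zero_apply, zero_add]
  exact congrArg (f z.x + ·) (sum_indicator (fun _ => Set.Ici 0) z.l)

theorem prox_F {f : EuclideanSpace ℝ (Fin d) → EReal} (hf_proper : IsProper f)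
    (hf_convex : IsConvexFun f) (hτ : 0 < τ) (hp : p ∈ prox τ f x)
    (y₀ : EuclideanSpace ℝ (Fin q)) (U : Mat (Fin q) (Fin k))
    (Θ : PiLp 2 (fun _ : Fin q => SymMat (Fin k))) {l l' : EuclideanSpace ℝ (Fin m)}
    (hl : l' ∈ proj (orthant m) l) :
    prox τ (F q k m f) (XSpace.mk x y₀ U Θ l) = {XSpace.mk p y₀ U Θ l'} := by
  have horthant : (orthant m).Nonempty := ⟨l', hl.1⟩
  rw [← prox_indicator horthant hτ] at hl
  rw [F_eq_sepSum]
  refine prox_sepSum hf_proper hf_convex ?_ ?_ hτ hp ?_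
  · exact isProper_zero_sepSum <| isProper_zero_sepSum <| isProper_zero_sepSum <|
      isProper_indicator horthant
  · exact isConvexFun_zero_sepSum <| isConvexFun_zero_sepSum <| isConvexFun_zero_sepSum <|
      isConvexFun_indicator convex_orthant
  · exact mem_prox_sepSum (self_mem_prox_zero hτ y₀) <| mem_prox_sepSum (self_mem_prox_zero hτ U) <|
      mem_prox_sepSum (self_mem_prox_zero hτ Θ) hl

theorem prox_conjugate_E {C : Set (EuclideanSpace ℝ (Fin d))} (hC : Convex ℝ C) (hσ : 0 < σ)
    (hp : p ∈ proj C (σ⁻¹ • x)) (y₀ : EuclideanSpace ℝ (Fin q)) (U : Mat (Fin q) (Fin k))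
    (Θ : PiLp 2 (fun _ : Fin q => SymMat (Fin k))) (l : EuclideanSpace ℝ (Fin m)) :
    prox σ (conjugate (E q k m C)) (XSpace.mk x y₀ U Θ l) = {XSpace.mk (x - σ • p) 0 0 0 0} := by
  have hC_nonempty : C.Nonempty := ⟨p, hp.1⟩
  have hE : E q k m C = sepSum (indicator C) 0 := by
    funext z
    exact (add_zero _).symm
  rw [← prox_indicator hC_nonempty (inv_pos.2 hσ)] at hp
  rw [hE]
  exact prox_conjugate_sepSum_zero (isProper_indicator hC_nonempty) (isConvexFun_indicator hC) hσ
    _ hp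

theorem prox_conjugate_G {B S : Fin m → SymMat (Fin k ⊕ Unit)} (hσ : 0 < σ) {Ψ : YSpace k m}
    (hS : ∀ i, S i ∈ proj (psdCone (Fin k ⊕ Unit)) (σ⁻¹ • Ψ i - B i)) :
    prox σ (conjugate (G B)) Ψ = {WithLp.toLp 2 fun i => Ψ i - σ • B i - σ • S i} :=
  prox_conjugate_sum_indicator_image_add (W := fun _ => SymMat (Fin k ⊕ Unit))
    (K := fun _ => psdCone _) (v := Ψ) (b := WithLp.toLp 2 B) (p := WithLp.toLp 2 S)
    (fun _ => convex_psdCone _) hσ hS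

end Functionals

section PolynomialDegrees

open MvPolynomial

variable {ι κ R : Type*}

theorem totalDegree_pderiv_lt [CommSemiring R] {i : ι} {p : MvPolynomial ι R}
    (hi : pderiv i p ≠ 0) : (pderiv i p).totalDegree < p.totalDegree := by
  obtain ⟨α, hα, hdeg⟩ := Finset.exists_mem_eq_sup _ (support_nonempty.2 hi)
    fun α : ι →₀ ℕ => α.sum fun _ e => e
  have hmem : α + Finsupp.single i 1 ∈ p.support := by
    rw [mem_support_iff, coeff_pderiv] at hα
    exact mem_support_iff.2 (left_ne_zero_of_mul hα)
  calc (pderiv i p).totalDegree < (α + Finsupp.single i 1).degree := by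
        rw [totalDegree, hdeg, map_add, Finsupp.degree_single]
        exact Nat.lt_succ_self _
    _ ≤ p.totalDegree := le_totalDegree hmem

theorem totalDegree_aeval_le [CommSemiring R] {φ : ι → MvPolynomial κ R}
    (hφ : ∀ i, (φ i).totalDegree ≤ 1) (p : MvPolynomial ι R) :
    (aeval φ p).totalDegree ≤ p.totalDegree := by
  rw [aeval_def, eval₂_eq]
  refine totalDegree_finsetSum_le fun α hα => ?_
  calc (algebraMap R (MvPolynomial κ R) (p.coeff α) * ∏ i ∈ α.support, φ i ^ α i).totalDegree
      ≤ ∑ i ∈ α.support, (φ i ^ α i).totalDegree := by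
        refine (totalDegree_mul _ _).trans ?_
        rw [algebraMap_eq, totalDegree_C, zero_add]
        exact totalDegree_finsetProd _ _
    _ ≤ ∑ i ∈ α.support, α i := Finset.sum_le_sum fun i _ =>
        (totalDegree_pow _ _).trans <| by simpa using Nat.mul_le_mul_left (α i) (hφ i)
    _ ≤ p.totalDegree := le_totalDegree hα

theorem totalDegree_X_sub_C_le [CommRing R] (i : ι) (c : R) :
    (X i - C c : MvPolynomial ι R).totalDegree ≤ 1 :=
  (totalDegree_sub_C_le _ _).trans <|
    (totalDegree_monomial_le _ _).trans_eq (Finsupp.degree_single i 1)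

theorem two_mul_totalDegree_le_totalDegree_sum_sq [Finite ι] [Fintype κ]
    (Q : κ → MvPolynomial ι ℝ) (k : κ) :
    2 * (Q k).totalDegree ≤ (∑ i, Q i ^ 2).totalDegree := by
  classical
  obtain ⟨_⟩ : Nonempty (LinearOrder ι) := ⟨linearOrderOfSTO WellOrderingRel⟩
  let m : MonomialOrder ι := MonomialOrder.degLex
  obtain ⟨i₀, -, hi₀⟩ := Finset.exists_max_image Finset.univ
    (fun i => m.toSyn (m.degree (Q i))) ⟨k, Finset.mem_univ k⟩
  have hk : (Q k).totalDegree ≤ (Q i₀).totalDegree :=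
    degLex_totalDegree_monotone (hi₀ k (Finset.mem_univ k))
  rcases eq_or_ne (Q i₀) 0 with hzero | hne
  · rw [hzero, totalDegree_zero] at hk
    omega
  set a := m.degree (Q i₀)
  -- The coefficient of the square of the leading monomial is a sum of squares, so it survives.
  have hcoeff : (∑ i, Q i ^ 2).coeff (a + a) = ∑ i, (Q i).coeff a ^ 2 := by
    rw [coeff_sum]
    refine Finset.sum_congr rfl fun i hi => ?_
    rw [sq, sq, m.coeff_mul_of_add_of_degree_le (hi₀ i hi) (hi₀ i hi)]
  have hpos : 0 < ∑ i, (Q i).coeff a ^ 2 :=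
    Finset.sum_pos' (fun i _ => sq_nonneg _)
      ⟨i₀, Finset.mem_univ _, sq_pos_of_ne_zero (m.coeff_degree_ne_zero_iff.2 hne)⟩
  have hlead : (a + a).degree ≤ (∑ i, Q i ^ 2).totalDegree :=
    le_totalDegree (mem_support_iff.2 (hcoeff ▸ hpos.ne'))
  have ha : a.degree = (Q i₀).totalDegree := degree_degLexDegree
  rw [map_add, ha] at hlead
  omega

end PolynomialDegrees

section Contractions

open MvPolynomial

variable {ι : Type*}

/-- Substitution of `u + t (x - u)` for the variable `x`: as `t` goes from `0` to `1`, it deforms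
evaluation at `u` into the identity. -/
noncomputable def contraction (u : ι → ℝ) (t : ℝ) : MvPolynomial ι ℝ →ₐ[ℝ] MvPolynomial ι ℝ :=
  aeval fun i => C (u i) + C t * (X i - C (u i))

variable (u : ι → ℝ) (t : ℝ)

theorem contraction_zero (p : MvPolynomial ι ℝ) : contraction u 0 p = C (eval u p) := by
  rw [contraction]
  simp only [C_0, zero_mul, add_zero]
  exact (aeval_algebraMap_apply (MvPolynomial ι ℝ) u p).trans (by rw [aeval_eq_eval]; rfl)

theorem contraction_one (p : MvPolynomial ι ℝ) : contraction u 1 p = p := by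
  simp [contraction]

theorem map_mul_contraction_X (L : MvPolynomial ι ℝ →ₗ[ℝ] ℝ) (p : MvPolynomial ι ℝ) (i : ι) :
    L (p * contraction u t (X i)) = u i * L p + t * L (p * (X i - C (u i))) := by
  rw [contraction, aeval_X, mul_add, mul_comm p, mul_left_comm, C_mul', C_mul', map_add, map_smul,
    map_smul, smul_eq_mul, smul_eq_mul]

theorem totalDegree_contraction_le (p : MvPolynomial ι ℝ) :
    (contraction u t p).totalDegree ≤ p.totalDegree := by
  refine totalDegree_aeval_le (fun i => ?_) p
  refine (totalDegree_add _ _).trans (max_le (by simp) ((totalDegree_mul _ _).trans ?_))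
  rw [totalDegree_C, zero_add]
  exact totalDegree_X_sub_C_le i (u i)

variable [Fintype ι]

/-- The operator `p ↦ ∑ i, T (∂ᵢ p) (xᵢ - uᵢ)`. For `T = contraction u t` it is the derivative of
`t ↦ contraction u t p`, and applying it twice gives the second derivative. -/
noncomputable def radialDeriv (T : MvPolynomial ι ℝ →ₗ[ℝ] MvPolynomial ι ℝ) :
    MvPolynomial ι ℝ →ₗ[ℝ] MvPolynomial ι ℝ :=
  ∑ i, LinearMap.mulRight ℝ (X i - C (u i)) ∘ₗ T ∘ₗ (pderiv i).toLinearMap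

theorem radialDeriv_apply (T : MvPolynomial ι ℝ →ₗ[ℝ] MvPolynomial ι ℝ) (p : MvPolynomial ι ℝ) :
    radialDeriv u T p = ∑ i, T (pderiv i p) * (X i - C (u i)) := by
  simp [radialDeriv, LinearMap.sum_apply]

theorem totalDegree_radialDeriv_le {T : MvPolynomial ι ℝ →ₗ[ℝ] MvPolynomial ι ℝ}
    (hT : ∀ p, (T p).totalDegree ≤ p.totalDegree) (p : MvPolynomial ι ℝ) :
    (radialDeriv u T p).totalDegree ≤ p.totalDegree := by
  rw [radialDeriv_apply]
  refine totalDegree_finsetSum_le fun i _ => ?_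
  rcases eq_or_ne (pderiv i p) 0 with hzero | hne
  · simp [hzero]
  · have hmul := totalDegree_mul (T (pderiv i p)) (X i - C (u i))
    have hlinear := totalDegree_X_sub_C_le i (u i)
    have hpderiv := hT (pderiv i p)
    have hlt := totalDegree_pderiv_lt hne
    omega

theorem radialDeriv_contraction_C (a : ℝ) :
    radialDeriv u (contraction u t).toLinearMap (C a) = 0 := by
  simp [radialDeriv_apply]

theorem radialDeriv_contraction_mul_X (p : MvPolynomial ι ℝ) (j : ι) :
    radialDeriv u (contraction u t).toLinearMap (p * X j) =
      radialDeriv u (contraction u t).toLinearMap p * contraction u t (X j) +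
        contraction u t p * (X j - C (u j)) := by
  classical
  have hsingle : ∑ i, contraction u t p *
      contraction u t (Pi.single (M := fun _ => MvPolynomial ι ℝ) i 1 j) * (X i - C (u i)) =
        contraction u t p * (X j - C (u j)) := by
    rw [Finset.sum_eq_single_of_mem j (Finset.mem_univ j) fun i _ hi => by
      rw [Pi.single_eq_of_ne hi.symm, map_zero, mul_zero, zero_mul]]
    rw [Pi.single_eq_same, map_one, mul_one]
  simp only [radialDeriv_apply, AlgHom.toLinearMap_apply, pderiv_mul, pderiv_X, map_add, map_mul,
    add_mul, Finset.sum_add_distrib, Finset.sum_mul, hsingle]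
  exact congrArg (· + _) (Finset.sum_congr rfl fun i _ => mul_right_comm _ _ _)

theorem hasDerivAt_map_contraction (L : MvPolynomial ι ℝ →ₗ[ℝ] ℝ) (p : MvPolynomial ι ℝ) :
    HasDerivAt (fun t => L (contraction u t p))
      (L (radialDeriv u (contraction u t).toLinearMap p)) t := by
  induction p using MvPolynomial.induction_on generalizing L with
  | C a =>
    rw [radialDeriv_contraction_C, map_zero]
    exact (hasDerivAt_const t (L (C a))).congr_of_eventuallyEq
      (Filter.Eventually.of_forall fun s => congrArg L ((contraction u s).commutes a))
  | add p q hp hq => simpa only [map_add] using (hp L).fun_add (hq L)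
  | mul_X p j hp =>
    have hprod := ((hp L).const_mul (u j)).fun_add <|
      (hasDerivAt_id' t).fun_mul (hp (L ∘ₗ LinearMap.mulRight ℝ (X j - C (u j))))
    simp only [LinearMap.comp_apply, LinearMap.mulRight_apply, ← map_mul_contraction_X] at hprod
    rw [radialDeriv_contraction_mul_X, map_add, map_mul_contraction_X]
    refine (hprod.congr_deriv (by ring)).congr_of_eventuallyEq
      (Filter.Eventually.of_forall fun s => ?_)
    simp only [map_mul, map_mul_contraction_X]

theorem hasDerivAt_map_radialDeriv_contraction (L : MvPolynomial ι ℝ →ₗ[ℝ] ℝ)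
    (p : MvPolynomial ι ℝ) :
    HasDerivAt (fun t => L (radialDeriv u (contraction u t).toLinearMap p))
      (L (radialDeriv u (radialDeriv u (contraction u t).toLinearMap) p)) t := by
  simp only [radialDeriv_apply u _ p, map_sum]
  exact HasDerivAt.fun_sum fun i _ =>
    hasDerivAt_map_contraction u t (L ∘ₗ LinearMap.mulRight ℝ (X i - C (u i))) (pderiv i p)

end Contractions

section Jensen

open MvPolynomial

variable {d n ν : ℕ} {p : MvPolynomial (Fin d) ℝ}

theorem radialDeriv_radialDeriv_contraction_eq_sum_sq
    {P : Matrix (Fin ν) (Fin d) (MvPolynomial (Fin d) ℝ)} (hP : hessian p = P.transpose * P)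
    (u : Fin d → ℝ) (t : ℝ) :
    radialDeriv u (radialDeriv u (contraction u t).toLinearMap) p =
      ∑ κ, (∑ i, contraction u t (P κ i) * (X i - C (u i))) ^ 2 := by
  have hentry (i j : Fin d) : pderiv j (pderiv i p) = ∑ κ, P κ j * P κ i := by
    simpa [hessian, Matrix.mul_apply] using congrFun (congrFun hP j) i
  simp only [radialDeriv_apply, AlgHom.toLinearMap_apply, hentry, map_sum, map_mul, sq,
    Finset.sum_mul, Finset.mul_sum]
  rw [Finset.sum_congr rfl fun _ _ => Finset.sum_comm, Finset.sum_comm]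
  refine Finset.sum_congr rfl fun κ _ => Finset.sum_congr rfl fun i _ =>
    Finset.sum_congr rfl fun j _ => ?_
  ring

/-- A pseudo-expectation of degree `n`: a linear functional on polynomials that sends `1` to `1`
and is nonnegative on the squares of degree at most `n`. Expectations with respect to probability
measures are the model case. -/
structure IsPseudoExpectation {ι : Type*} (n : ℕ) (L : MvPolynomial ι ℝ →ₗ[ℝ] ℝ) : Prop where
  map_one : L 1 = 1
  map_sq_nonneg : ∀ q : MvPolynomial ι ℝ, 2 * q.totalDegree ≤ n → 0 ≤ L (q ^ 2)

namespace IsPseudoExpectation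

section

variable {ι : Type*} {L L' : MvPolynomial ι ℝ →ₗ[ℝ] ℝ}

theorem map_C (hL : IsPseudoExpectation n L) (a : ℝ) : L (C a) = a := by
  rw [← mul_one (C a), C_mul', map_smul, hL.map_one, smul_eq_mul, mul_one]

theorem map_sum_sq_nonneg [Finite ι] (hL : IsPseudoExpectation n L) {κ : Type*} [Fintype κ]
    (Q : κ → MvPolynomial ι ℝ) (hQ : (∑ k, Q k ^ 2).totalDegree ≤ n) :
    0 ≤ L (∑ k, Q k ^ 2) := by
  rw [map_sum]
  exact Finset.sum_nonneg fun k _ => hL.map_sq_nonneg _ <|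
    (two_mul_totalDegree_le_totalDegree_sum_sq Q k).trans hQ

theorem map_radialDeriv_contraction_zero [Fintype ι] (hL : IsPseudoExpectation n L)
    (p : MvPolynomial ι ℝ) :
    L (radialDeriv (fun i => L (X i)) (contraction (fun i => L (X i)) 0).toLinearMap p) = 0 := by
  rw [radialDeriv_apply, map_sum]
  refine Finset.sum_eq_zero fun i _ => ?_
  rw [AlgHom.toLinearMap_apply, contraction_zero, C_mul', map_smul, map_sub, hL.map_C, sub_self,
    smul_zero]

protected theorem aeval (n : ℕ) (x : ι → ℝ) :
    IsPseudoExpectation n (aeval (R := ℝ) x).toLinearMap where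
  map_one := _root_.map_one (aeval (R := ℝ) x)
  map_sq_nonneg q _ := by
    rw [AlgHom.toLinearMap_apply, map_pow]
    exact sq_nonneg _

theorem convex_combo (hL : IsPseudoExpectation n L) (hL' : IsPseudoExpectation n L') {a b : ℝ}
    (ha : 0 ≤ a) (hb : 0 ≤ b) (hab : a + b = 1) : IsPseudoExpectation n (a • L + b • L') where
  map_one := by simp [hL.map_one, hL'.map_one, hab]
  map_sq_nonneg q hq :=
    add_nonneg (mul_nonneg ha (hL.map_sq_nonneg q hq)) (mul_nonneg hb (hL'.map_sq_nonneg q hq))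

end

theorem eval_le_map {L : MvPolynomial (Fin d) ℝ →ₗ[ℝ] ℝ} (hL : IsPseudoExpectation n L)
    (hp : IsSOSConvex p) (hdeg : p.totalDegree ≤ n) : eval (fun i => L (X i)) p ≤ L p := by
  obtain ⟨ν, P, hP⟩ := hp
  set u : Fin d → ℝ := fun i => L (X i)
  set φ : ℝ → ℝ := fun t => L (contraction u t p)
  set φ' : ℝ → ℝ := fun t => L (radialDeriv u (contraction u t).toLinearMap p)
  have hφ (t : ℝ) : HasDerivAt φ (φ' t) t := hasDerivAt_map_contraction u t L p
  have second_deriv_nonneg (t : ℝ) :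
      0 ≤ L (radialDeriv u (radialDeriv u (contraction u t).toLinearMap) p) := by
    have hle := totalDegree_radialDeriv_le u (totalDegree_radialDeriv_le u
      (T := (contraction u t).toLinearMap) (totalDegree_contraction_le u t)) p
    rw [radialDeriv_radialDeriv_contraction_eq_sum_sq hP] at hle ⊢
    exact hL.map_sum_sq_nonneg _ (hle.trans hdeg)
  have hφ'_mono : Monotone φ' :=
    monotone_of_hasDerivAt_nonneg (hasDerivAt_map_radialDeriv_contraction u · L p)
      second_deriv_nonneg
  have hφ_convex : ConvexOn ℝ Set.univ φ :=
    Monotone.convexOn_univ_of_deriv (fun t => (hφ t).differentiableAt) <| by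
      rwa [funext fun t => (hφ t).deriv]
  have hφ'_zero : φ' 0 = 0 := hL.map_radialDeriv_contraction_zero p
  have hslope := hφ_convex.le_slope_of_hasDerivAt trivial trivial zero_lt_one (hφ 0)
  rw [hφ'_zero, slope_def_field, sub_zero, div_one, sub_nonneg] at hslope
  simpa only [φ, contraction_zero, contraction_one, hL.map_C] using hslope

end IsPseudoExpectation

theorem IsSOSConvex.convexOn_eval (hp : IsSOSConvex p) :
    ConvexOn ℝ Set.univ fun x : Fin d → ℝ => eval x p := by
  refine ⟨convex_univ, fun x _ z _ a b ha hb hab => ?_⟩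
  have hL := (IsPseudoExpectation.aeval p.totalDegree x).convex_combo
    (IsPseudoExpectation.aeval p.totalDegree z) ha hb hab
  have h := hL.eval_le_map hp le_rfl
  simp only [LinearMap.add_apply, LinearMap.smul_apply, AlgHom.toLinearMap_apply, aeval_X,
    aeval_eq_eval, smul_eq_mul] at h
  exact h

end Jensen

section MomentProgram

open MvPolynomial

variable {d n s : ℕ} {g : Fin s → MvPolynomial (Fin d) ℝ}

/-- The Riesz functional `p ↦ ∑_α p_α y_α` as a linear map on polynomials; coefficients of degree
larger than `n` are ignored. -/
noncomputable def rieszLinear (y : MultiIndex d n → ℝ) : MvPolynomial (Fin d) ℝ →ₗ[ℝ] ℝ where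
  toFun := riesz y
  map_add' p q := by simp [riesz, add_mul, Finset.sum_add_distrib]
  map_smul' c p := by simp [riesz, Finset.mul_sum, mul_assoc]

theorem rieszLinear_monomial (y : MultiIndex d n → ℝ) (α : MultiIndex d n) (c : ℝ) :
    rieszLinear y (monomial α.1 c) = c * y α := by
  change ∑ β : MultiIndex d n, _ = _
  rw [Finset.sum_eq_single_of_mem α (Finset.mem_univ α) fun β _ hβ => by
    rw [coeff_monomial, if_neg fun h => hβ (Subtype.ext h).symm, zero_mul]]
  rw [coeff_monomial, if_pos rfl]

theorem rieszLinear_X (hn : 2 ≤ n) (y : MultiIndex d n → ℝ) (i : Fin d) :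
    rieszLinear y (X i) = firstMoments hn y i :=
  (rieszLinear_monomial y (MultiIndex.unit hn i) 1).trans (one_mul _)

theorem sum_monomial_coeff {p : MvPolynomial (Fin d) ℝ} (hp : p.totalDegree ≤ n) :
    ∑ α : MultiIndex d n, monomial α.1 (p.coeff α.1) = p := by
  conv_rhs => rw [p.as_sum]
  exact Finset.sum_bij_ne_zero (fun α _ _ => α.1)
    (fun α _ hα => mem_support_iff.2 fun h => hα (by rw [h, map_zero]))
    (fun α _ _ β _ _ h => Subtype.ext h)
    (fun β hβ _ => ⟨⟨β, (le_totalDegree hβ).trans hp⟩, Finset.mem_univ _, by assumption, rfl⟩)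
    (fun _ _ _ => rfl)

/-- The moment matrix `∑_α y_α M_α`, whose `(β, γ)` entry is `y_{β+γ}`. -/
noncomputable def momentMatrix (y : MultiIndex d n → ℝ) :
    Matrix (MultiIndex d (n / 2)) (MultiIndex d (n / 2)) ℝ :=
  ∑ α, y α • momentBasis α

theorem momentMatrix_apply (y : MultiIndex d n → ℝ) (β γ : MultiIndex d (n / 2)) :
    momentMatrix y β γ = rieszLinear y (monomial β.1 1 * monomial γ.1 1) := by
  rw [monomial_mul, momentMatrix, Matrix.sum_apply]
  refine Finset.sum_congr rfl fun α _ => ?_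
  simp [momentBasis, coeff_monomial]

theorem rieszLinear_sq (y : MultiIndex d n → ℝ) {p : MvPolynomial (Fin d) ℝ}
    (hp : p.totalDegree ≤ n / 2) :
    rieszLinear y (p ^ 2) = (fun β : MultiIndex d (n / 2) => p.coeff β.1) ⬝ᵥ
      (momentMatrix y).mulVec fun β => p.coeff β.1 := by
  have monomial_eq (β : Fin d →₀ ℕ) (c : ℝ) : monomial β c = c • monomial β 1 := by
    rw [smul_monomial, smul_eq_mul, mul_one]
  conv_lhs => rw [← sum_monomial_coeff hp, sq, Finset.sum_mul_sum]
  simp only [map_sum, dotProduct, Matrix.mulVec, Finset.mul_sum, momentMatrix_apply]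
  refine Finset.sum_congr rfl fun β _ => Finset.sum_congr rfl fun γ _ => ?_
  rw [monomial_eq, monomial_eq γ.1, smul_mul_smul_comm, map_smul, smul_eq_mul]
  ring

theorem IsMomentFeasible.isPseudoExpectation {y : MultiIndex d n → ℝ}
    (hy : IsMomentFeasible g y) : IsPseudoExpectation n (rieszLinear y) where
  map_one := (rieszLinear_monomial y (MultiIndex.zero d n) 1).trans (by rw [hy.2.2, one_mul])
  map_sq_nonneg q hq := by
    rw [rieszLinear_sq y (by omega)]
    exact hy.2.1.dotProduct_mulVec_nonneg fun β => q.coeff β.1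

theorem IsMomentFeasible.eval_firstMoments_le {y : MultiIndex d n → ℝ}
    (hy : IsMomentFeasible g y) (hn : 2 ≤ n) {p : MvPolynomial (Fin d) ℝ}
    (hp : IsSOSConvex p) (hdeg : p.totalDegree ≤ n) :
    eval (fun i => firstMoments hn y i) p ≤ riesz y p := by
  have h := hy.isPseudoExpectation.eval_le_map hp hdeg
  simp only [rieszLinear_X hn] at h
  exact h

/-- The moments `x^α` of the Dirac measure at `x`. -/
noncomputable def diracMoments (n : ℕ) (x : EuclideanSpace ℝ (Fin d)) : MultiIndex d n → ℝ :=
  fun α => eval (fun i => x i) (monomial α.1 1)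

theorem riesz_diracMoments (x : EuclideanSpace ℝ (Fin d)) {p : MvPolynomial (Fin d) ℝ}
    (hp : p.totalDegree ≤ n) : riesz (diracMoments n x) p = eval (fun i => x i) p := by
  conv_rhs => rw [← sum_monomial_coeff hp, map_sum]
  refine Finset.sum_congr rfl fun α _ => ?_
  rw [diracMoments, eval_monomial, eval_monomial, one_mul]

theorem momentMatrix_diracMoments (x : EuclideanSpace ℝ (Fin d)) :
    momentMatrix (diracMoments n x) =
      Matrix.vecMulVec (diracMoments (n / 2) x) (diracMoments (n / 2) x) := by
  ext β γ
  have hdeg : (monomial β.1 1 * monomial γ.1 1 : MvPolynomial (Fin d) ℝ).totalDegree ≤ n := by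
    rw [monomial_mul]
    refine (totalDegree_monomial_le _ _).trans ?_
    exact (map_add Finsupp.degree β.1 γ.1).trans_le ((add_le_add β.2 γ.2).trans (by omega))
  exact (momentMatrix_apply _ β γ).trans <| (riesz_diracMoments x hdeg).trans (map_mul _ _ _)

theorem isMomentFeasible_diracMoments (hdeg : ∀ j, (g j).totalDegree ≤ n)
    {x : EuclideanSpace ℝ (Fin d)} (hx : x ∈ feasibleSet g) :
    IsMomentFeasible g (diracMoments n x) := by
  refine ⟨fun j => (riesz_diracMoments x (hdeg j)).trans_le (hx j), ?_, ?_⟩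
  · change (momentMatrix _).PosSemidef
    rw [momentMatrix_diracMoments]
    exact Matrix.posSemidef_vecMulVec_self_star (diracMoments (n / 2) x)
  · exact map_one _

theorem isClosed_feasibleSet (g : Fin s → MvPolynomial (Fin d) ℝ) : IsClosed (feasibleSet g) := by
  simp only [feasibleSet, Set.ofPred_forall]
  exact isClosed_iInter fun j =>
    isClosed_le ((continuous_eval (g j)).comp (by fun_prop)) continuous_const

theorem convex_feasibleSet (hg : ∀ j, IsSOSConvex (g j)) : Convex ℝ (feasibleSet g) := by
  simp only [feasibleSet, Set.ofPred_forall]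
  refine convex_iInter fun j => ?_
  have h := ((hg j).convexOn_eval.comp_linearMap
    (WithLp.linearEquiv 2 ℝ (Fin d → ℝ)).toLinearMap).convex_le 0
  simpa using h

theorem totalDegree_sqDistPoly_le (v : EuclideanSpace ℝ (Fin d)) :
    (sqDistPoly v).totalDegree ≤ 2 := by
  refine totalDegree_finsetSum_le fun i _ => ?_
  rw [← neg_sub, neg_sq]
  refine (totalDegree_pow _ _).trans ?_
  have := totalDegree_X_sub_C_le i (v i)
  omega

theorem eval_sqDistPoly (v x : EuclideanSpace ℝ (Fin d)) :
    eval (fun i => x i) (sqDistPoly v) = ‖x - v‖ ^ 2 := by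
  simp only [sqDistPoly, map_sum, map_pow, map_sub, eval_C, eval_X, EuclideanSpace.norm_sq_eq,
    PiLp.sub_apply, Real.norm_eq_abs, sq_abs]
  exact Finset.sum_congr rfl fun i _ => sub_sq_comm _ _

theorem hessian_sqDistPoly (v : EuclideanSpace ℝ (Fin d)) :
    hessian (sqDistPoly v) = Matrix.diagonal fun _ => 2 := by
  ext1 i j
  have hgradient : pderiv j (sqDistPoly v) = (2 : ℝ) • (X j - C (v j)) := by
    rw [sqDistPoly, map_sum, Finset.sum_eq_single_of_mem j (Finset.mem_univ j) fun i _ hi => by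
      simp [Derivation.leibniz_pow, pderiv_X, Pi.single_eq_of_ne hi]]
    simp [Derivation.leibniz_pow, ofNat_smul_eq_nsmul]
  rw [hessian, Matrix.of_apply, hgradient, Derivation.map_smul, map_sub, pderiv_C, sub_zero,
    pderiv_X, Matrix.diagonal_apply]
  rcases eq_or_ne i j with rfl | hne
  · simp [smul_eq_C_mul, map_ofNat C 2]
  · simp [hne]

theorem isSOSConvex_sqDistPoly (v : EuclideanSpace ℝ (Fin d)) : IsSOSConvex (sqDistPoly v) := by
  refine ⟨d, Matrix.diagonal fun _ => C (Real.sqrt 2), ?_⟩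
  rw [hessian_sqDistPoly, Matrix.diagonal_transpose, Matrix.diagonal_mul_diagonal]
  simp only [← C_mul, Real.mul_self_sqrt zero_le_two, map_ofNat]

theorem IsMomentFeasible.norm_firstMoments_sub_sq_le {y : MultiIndex d n → ℝ}
    (hy : IsMomentFeasible g y) (hn : 2 ≤ n) (v : EuclideanSpace ℝ (Fin d)) :
    ‖firstMoments hn y - v‖ ^ 2 ≤ riesz y (sqDistPoly v) := by
  rw [← eval_sqDistPoly]
  exact hy.eval_firstMoments_le hn (isSOSConvex_sqDistPoly v)
    ((totalDegree_sqDistPoly_le v).trans hn)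

theorem riesz_diracMoments_sqDistPoly (hn : 2 ≤ n) (v x : EuclideanSpace ℝ (Fin d)) :
    riesz (diracMoments n x) (sqDistPoly v) = ‖x - v‖ ^ 2 := by
  rw [riesz_diracMoments x ((totalDegree_sqDistPoly_le v).trans hn), eval_sqDistPoly]

theorem IsMomentFeasible.firstMoments_mem {y : MultiIndex d n → ℝ} (hy : IsMomentFeasible g y)
    (hn : 2 ≤ n) (hg : ∀ j, IsSOSConvex (g j)) (hdeg : ∀ j, (g j).totalDegree ≤ n) :
    firstMoments hn y ∈ feasibleSet g := fun j =>
  (hy.eval_firstMoments_le hn (hg j) (hdeg j)).trans (hy.1 j)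

theorem isMomentSolution_diracMoments (hn : 2 ≤ n) (hg : ∀ j, IsSOSConvex (g j))
    (hdeg : ∀ j, (g j).totalDegree ≤ n) {v p : EuclideanSpace ℝ (Fin d)}
    (hp : p ∈ proj (feasibleSet g) v) : IsMomentSolution g v (diracMoments n p) := by
  refine ⟨isMomentFeasible_diracMoments hdeg hp.1, fun y hy => ?_⟩
  calc riesz (diracMoments n p) (sqDistPoly v) = ‖p - v‖ ^ 2 :=
        riesz_diracMoments_sqDistPoly hn v p
    _ ≤ ‖firstMoments hn y - v‖ ^ 2 := by
        gcongr
        exact hp.2 _ (hy.firstMoments_mem hn hg hdeg)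
    _ ≤ riesz y (sqDistPoly v) := hy.norm_firstMoments_sub_sq_le hn v

theorem IsMomentSolution.firstMoments_mem_proj {v : EuclideanSpace ℝ (Fin d)}
    {y : MultiIndex d n → ℝ} (hy : IsMomentSolution g v y) (hn : 2 ≤ n)
    (hg : ∀ j, IsSOSConvex (g j)) (hdeg : ∀ j, (g j).totalDegree ≤ n) :
    firstMoments hn y ∈ proj (feasibleSet g) v := by
  refine ⟨hy.1.firstMoments_mem hn hg hdeg, fun w hw => le_of_sq_le_sq ?_ (norm_nonneg _)⟩
  calc ‖firstMoments hn y - v‖ ^ 2 ≤ riesz y (sqDistPoly v) :=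
        hy.1.norm_firstMoments_sub_sq_le hn v
    _ ≤ riesz (diracMoments n w) (sqDistPoly v) := hy.2 _ (isMomentFeasible_diracMoments hdeg hw)
    _ = ‖w - v‖ ^ 2 := riesz_diracMoments_sqDistPoly hn v w

end MomentProgram

end TwoStageARO

open TwoStageARO in
theorem mainTheorem6 (d q k m s : ℕ)
    -- the objective
    (f : EuclideanSpace ℝ (Fin d) → EReal) (hf_proper : IsProper f) (hf_convex : IsConvexFun f)
    (hf_lsc : LowerSemicontinuous f)
    -- the constraint set `C`
    (C : Set (EuclideanSpace ℝ (Fin d))) (hC_nonempty : C.Nonempty) (hC_closed : IsClosed C)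
    (hC_convex : Convex ℝ C)
    -- the constraint set `D`, given by SOS-convex polynomials
    (g : Fin s → MvPolynomial (Fin d) ℝ) (hg : ∀ j, IsSOSConvex (g j))
    (hD_nonempty : (feasibleSet g).Nonempty)
    -- the right-hand sides, which determine the matrices `B_i`
    (b₀ : Fin m → ℝ) (b : Fin m → Fin k → ℝ)
    -- the step sizes and the points
    (τ σ : ℝ) (hτ : 0 < τ) (hσ : 0 < σ)
    (x : EuclideanSpace ℝ (Fin d)) (y₀ : EuclideanSpace ℝ (Fin q)) (U : Mat (Fin q) (Fin k))
    (Θ : PiLp 2 (fun _ : Fin q => SymMat (Fin k))) (l : EuclideanSpace ℝ (Fin m))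
    (Ψ : YSpace k m) :
    -- (i)
    (∃ p : EuclideanSpace ℝ (Fin d), ∃ l' : EuclideanSpace ℝ (Fin m),
      prox τ f x = {p} ∧ proj (orthant m) l = {l'} ∧ (∀ i, l' i = max (l i) 0) ∧
      prox τ (F q k m f) (XSpace.mk x y₀ U Θ l) = {XSpace.mk p y₀ U Θ l'}) ∧
    -- (ii)
    (∃ p : EuclideanSpace ℝ (Fin d),
      proj C (σ⁻¹ • x) = {p} ∧
      prox σ (conjugate (E q k m C)) (XSpace.mk x y₀ U Θ l) =
        {XSpace.mk (x - σ • p) 0 0 0 0}) ∧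
    -- (iii)
    (∃ S : Fin m → SymMat (Fin k ⊕ Unit),
      (∀ i, proj (psdCone (Fin k ⊕ Unit)) (σ⁻¹ • Ψ i - bMatrix (b₀ i) (b i)) = {S i}) ∧
      prox σ (conjugate (G fun i => bMatrix (b₀ i) (b i))) Ψ =
        {WithLp.toLp 2 fun i => Ψ i - σ • bMatrix (b₀ i) (b i) - σ • S i}) ∧
    -- (iv)
    (∃ p : EuclideanSpace ℝ (Fin d),
      proj (feasibleSet g) (σ⁻¹ • x) = {p} ∧
      prox σ (conjugate (H q k m g)) (XSpace.mk x y₀ U Θ l) =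
        {XSpace.mk (x - σ • p) 0 0 0 0}) ∧
    (∀ v : EuclideanSpace ℝ (Fin d),
      (∃ y : MultiIndex d (truncOrder g) → ℝ, IsMomentSolution g v y) ∧
      ∀ y : MultiIndex d (truncOrder g) → ℝ, IsMomentSolution g v y →
        proj (feasibleSet g) v = {firstMoments (truncOrder_spec g).2.1 y}) := by
  obtain ⟨hn, hdeg⟩ := (truncOrder_spec g).2
  have hD_proj := exists_proj_eq_singleton hD_nonempty (isClosed_feasibleSet g)
    (convex_feasibleSet hg)
  refine ⟨?_, ?_, ?_, ?_, fun v => ⟨?_, fun y hy => ?_⟩⟩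
  · obtain ⟨p, hp⟩ := exists_prox_eq_singleton hf_proper hf_convex hf_lsc hτ x
    have hl := proj_orthant l
    exact ⟨p, _, hp, hl, fun _ => rfl, prox_F hf_proper hf_convex hτ (hp.ge rfl) y₀ U Θ (hl.ge rfl)⟩
  · obtain ⟨p, hp⟩ := exists_proj_eq_singleton hC_nonempty hC_closed hC_convex (σ⁻¹ • x)
    exact ⟨p, hp, prox_conjugate_E hC_convex hσ (hp.ge rfl) y₀ U Θ l⟩
  · choose S hS using fun i => exists_proj_eq_singleton (psdCone_nonempty (Fin k ⊕ Unit))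
      (isClosed_psdCone _) (convex_psdCone _) (σ⁻¹ • Ψ i - bMatrix (b₀ i) (b i))
    exact ⟨S, hS, prox_conjugate_G hσ fun i => (hS i).ge rfl⟩
  · obtain ⟨p, hp⟩ := hD_proj (σ⁻¹ • x)
    exact ⟨p, hp, prox_conjugate_E (convex_feasibleSet hg) hσ (hp.ge rfl) y₀ U Θ l⟩
  · obtain ⟨p, hp⟩ := hD_proj v
    exact ⟨_, isMomentSolution_diracMoments hn hg hdeg (hp.ge rfl)⟩
  · exact proj_eq_singleton_of_mem (convex_feasibleSet hg) (hy.firstMoments_mem_proj hn hg hdeg)
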